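/- For $\boldsymbol{\mu}=(\alpha,\beta,\gamma,\alpha',\beta',\gamma')\in\mathbb{C}^6$ let $T(n,k)=T(n,k;\boldsymbol{\mu})$ be the array defined by $T(0,k)=\delta_{k0}$ and $$T(n,k)=(\alpha n+\beta k+\gamma)\,T(n-1,k)+(\alpha' n+\beta' k+\gamma')\,T(n-1,k-1)\qquad(n\ge 1,\ k\in\mathbb{Z}),$$ and let $P_n(x;\boldsymbol{\mu})=\sum_{k=0}^n T(n,k;\boldsymbol{\mu})\,x^k$ and $f(x,t;\boldsymbol{\mu})=\sum_{n\ge 0}P_n(x;\boldsymbol{\mu})\,t^n\in\mathbb{C}[x][[t]]$. Consider representations $$f(x,t;\boldsymbol{\mu})=\cfrac{1}{1-\cfrac{c_1t}{1-\cfrac{c_2t}{1-\cdots}}}\qquad\text{with } c_1,c_2,\ldots\in\mathbb{C}[x],\tag{$*$}$$ understood in the sense of formal power series in $t$, and call such a representation nonterminating if no $c_i$ is the zero polynomial. **Theorem 3.1.** If $f(x,t;\boldsymbol{\mu})$ has a nonterminating representation $(*)$, then $\boldsymbol{\mu}$ belongs to at least one of the following ten families, where the parameters on the right-hand sides range over $\mathbb{C}$: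 - 1a. $\boldsymbol{\mu}=(0,\beta,0,\alpha',-\alpha',\gamma')$ - 1b. $\boldsymbol{\mu}=(0,\beta,\gamma,\alpha',-\alpha',0)$ - 2a. $\boldsymbol{\mu}=(\alpha,-\alpha,-\alpha,\alpha',\beta',\gamma')$ - 2b. $\boldsymbol{\mu}=(\alpha,\beta,\gamma,0,\beta',-\beta')$ - 3a. $\boldsymbol{\mu}=(0,\beta,0,0,\beta',\gamma')$ - 3b. $\boldsymbol{\mu}=(\alpha,-\alpha,\gamma,\alpha',-\alpha',0)$ - 4a. $\boldsymbol{\mu}=(0,\kappa\beta',\kappa(\beta'+\gamma'),0,\beta',\gamma')$ - 4b. $\boldsymbol{\mu}=(\alpha,-\alpha,\gamma,\kappa\alpha,-\kappa\alpha,\kappa(\alpha+\gamma))$ - 5. $\boldsymbol{\mu}=(\alpha,0,\gamma,\alpha',0,\gamma')$ - 6. $\boldsymbol{\mu}=(\kappa(\alpha'+\beta'),\kappa\beta',\kappa\gamma',\alpha',\beta',\gamma')$ Conversely, for every $\boldsymbol{\mu}$ in any of these ten families, $f(x,t;\boldsymbol{\mu})$ has a representation $(*)$ with coefficients $c_i\in\mathbb{C}[x]$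 (possibly terminating, that is, with some $c_i=0$, in degenerate cases). -/

import Mathlib

/-- A parameter vector `μ = (α, β, γ, α', β', γ') ∈ ℂ⁶` of the Graham–Knuth–Patashnik recurrence. -/
@[ext]
structure GKPParam where
  α : ℂ
  β : ℂ
  γ : ℂ
  α' : ℂ
  β' : ℂ
  γ' : ℂ

namespace GKPParam

/-- The GKP array: `T(0,k) = δ_{k0}` and, for `n ≥ 1` and `k ∈ ℤ`,
`T(n,k) = (α n + β k + γ) T(n-1,k) + (α' n + β' k + γ') T(n-1,k-1)`. -/
def T (μ : GKPParam) : ℕ → ℤ → ℂ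
  | 0, k => if k = 0 then 1 else 0
  | n + 1, k =>
      (μ.α * ((n + 1 : ℕ) : ℂ) + μ.β * (k : ℂ) + μ.γ) * T μ n k
        + (μ.α' * ((n + 1 : ℕ) : ℂ) + μ.β' * (k : ℂ) + μ.γ') * T μ n (k - 1)

/-- The row-generating polynomial `P_n(x) = ∑_{k=0}^n T(n,k) x^k`. -/
noncomputable def rowPoly (μ : GKPParam) (n : ℕ) : Polynomial ℂ :=
  ∑ k ∈ Finset.range (n + 1), Polynomial.C (μ.T n (k : ℤ)) * Polynomial.X ^ k

/-- The ordinary generating function `f(x,t) = ∑_{n ≥ 0} P_n(x) t^n`, a formal power series in `t`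
with coefficients in `ℂ[x]`. -/
noncomputable def ogf (μ : GKPParam) : PowerSeries (Polynomial ℂ) :=
  PowerSeries.mk μ.rowPoly

end GKPParam

/-- `sFractionConvergent c n i` is the finite continued fraction of depth `n`
`1 / (1 - c_i t / (1 - c_{i+1} t / ( ⋯ / (1 - c_{i+n-1} t))))`,
as a formal power series in `t`; at depth `0` it is `1`. Every denominator has constant term `1`,
hence is invertible, and `PowerSeries.invOfUnit _ 1` is its inverse
(see `sFractionConvergent_succ_spec`). -/
noncomputable def sFractionConvergent {R : Type*} [CommRing R] (c : ℕ → R) :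
    ℕ → ℕ → PowerSeries R
  | 0, _ => 1
  | n + 1, i =>
      PowerSeries.invOfUnit
        (1 - PowerSeries.C (c i) * PowerSeries.X * sFractionConvergent c n (i + 1)) 1

theorem sFractionConvergent_succ_spec {R : Type*} [CommRing R] (c : ℕ → R) (n i : ℕ) :
    (1 - PowerSeries.C (c i) * PowerSeries.X * sFractionConvergent c n (i + 1))
      * sFractionConvergent c (n + 1) i = 1 := by
  rw [sFractionConvergent]
  exact PowerSeries.mul_invOfUnit _ _ (by simp)

/-- `f = 1 / (1 - c₁ t / (1 - c₂ t / (1 - ⋯)))` as formal power series in `t`: the finite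
continued fractions `1 / (1 - c₁ t / (⋯ / (1 - c_N t)))` converge to `f` coefficientwise, each
coefficient being eventually constant in `N`. The value `c 0` is not used. A vanishing `c i` with
`i ≥ 1` is allowed, and makes the continued fraction terminate there. -/
def HasSFraction {R : Type*} [CommRing R] (f : PowerSeries R) (c : ℕ → R) : Prop :=
  ∀ n : ℕ, ∀ᶠ N : ℕ in Filter.atTop,
    PowerSeries.coeff n (sFractionConvergent c N 1) = PowerSeries.coeff n f

namespace GKPParam

def family1a : Set GKPParam := {μ | ∃ β α' γ' : ℂ, μ = ⟨0, β, 0, α', -α', γ'⟩}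

def family1b : Set GKPParam := {μ | ∃ β γ α' : ℂ, μ = ⟨0, β, γ, α', -α', 0⟩}

def family2a : Set GKPParam := {μ | ∃ α α' β' γ' : ℂ, μ = ⟨α, -α, -α, α', β', γ'⟩}

def family2b : Set GKPParam := {μ | ∃ α β γ β' : ℂ, μ = ⟨α, β, γ, 0, β', -β'⟩}

def family3a : Set GKPParam := {μ | ∃ β β' γ' : ℂ, μ = ⟨0, β, 0, 0, β', γ'⟩}

def family3b : Set GKPParam := {μ | ∃ α γ α' : ℂ, μ = ⟨α, -α, γ, α', -α', 0⟩}

def family4a : Set GKPParam :=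
  {μ | ∃ κ β' γ' : ℂ, μ = ⟨0, κ * β', κ * (β' + γ'), 0, β', γ'⟩}

def family4b : Set GKPParam :=
  {μ | ∃ κ α γ : ℂ, μ = ⟨α, -α, γ, κ * α, -(κ * α), κ * (α + γ)⟩}

def family5 : Set GKPParam := {μ | ∃ α γ α' γ' : ℂ, μ = ⟨α, 0, γ, α', 0, γ'⟩}

def family6 : Set GKPParam :=
  {μ | ∃ κ α' β' γ' : ℂ, μ = ⟨κ * (α' + β'), κ * β', κ * γ', α', β', γ'⟩}

/-- The union of the ten families. -/
def families : Set GKPParam :=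
  family1a ∪ family1b ∪ family2a ∪ family2b ∪ family3a ∪ family3b ∪ family4a ∪ family4b
    ∪ family5 ∪ family6

end GKPParam

/-!
Write `u = α + α' x`, `v = β x + β' x²` and `q = (α + γ) + (α' + β' + γ') x`. The array recurrence
says that `f` solves the first-order linear equation `D f = -1 + (1 - t q) f`, where `D` is the
derivation `t² u ∂/∂t + t v ∂/∂x` (`GKPParam.riccatiDefect_ogf`).

This is the case `p = 0`, `c = q` of the Riccati equation `D g = -1 + (1 + t (p - c)) g - p t g²`.
If `g` solves it and `g = 1 / (1 - c t h)` with `c ≠ 0`, then `h` solves the equation with `(c, e)`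
in place of `(p, c)` exactly when `c (e - p - u) = v c'` (`riccatiDefect_eq`). Hence, with `c₀ = 0`,
polynomials `c₁ = q, c₂, …` satisfying `c_{i+1} (c_{i+2} - c_i - u) = v c_{i+1}'` are S-fraction
coefficients of `f`, and coefficients that never vanish must satisfy this recurrence
(`GKPParam.hasSFraction_of_recurrence`, `GKPParam.recurrence_of_hasSFraction`).

In each of the ten families the recurrence is solved by two arithmetic progressions, `c_{2k} = k U`
and `c_{2k+1} = q + k W` (`GKPParam.exists_hasSFraction_of_progressions`).

Conversely, let the recurrence have nonzero polynomial solutions. If `v = 0`, this is family 5.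
Otherwise all `c_i` have degree at most one (`natDegree_le_one_of_recurrence`), and each with
`i ≥ 1` is either constant, or a multiple of `x`, or has two terms and is proportional to `β + β' x`. In each case the recurrence prescribes the increment
`c_{i+2} - c_i` (`CoeffStep`). Rescaling reduces to linear conditions with `β = β' = 1`, reversal of
polynomials exchanges families `a` and `b`, and the possible shapes of `c₁, …, c₆` leave only the
ten families (`GKPParam.mem_families_of_recurrence`).
-/

open Polynomial

/-! ### Tails of an S-fraction -/

section Tails

theorem PowerSeries.coeff_zero_mul {S : Type*} [CommRing S] (f g : PowerSeries S) :
    PowerSeries.coeff 0 (f * g) = PowerSeries.coeff 0 f * PowerSeries.coeff 0 g := by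
  simp

variable {R : Type*} [CommRing R]

/-- Increasing the depth from `n` to `n + 1` changes no coefficient of `t ^ m` with `m ≤ n`. -/
theorem sFractionConvergent_succ_sub_dvd (c : ℕ → R) (n i : ℕ) :
    (PowerSeries.X : PowerSeries R) ^ (n + 1) ∣
      sFractionConvergent c (n + 1) i - sFractionConvergent c n i := by
  induction n generalizing i with
  | zero =>
    have h := sFractionConvergent_succ_spec c 0 i
    refine ⟨PowerSeries.C (c i) * sFractionConvergent c 0 (i + 1) * sFractionConvergent c 1 i, ?_⟩
    simp only [sFractionConvergent] at h ⊢
    linear_combination h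
  | succ n ih =>
    obtain ⟨w, hw⟩ := ih (i + 1)
    have h₁ := sFractionConvergent_succ_spec c n i
    have h₂ := sFractionConvergent_succ_spec c (n + 1) i
    refine ⟨PowerSeries.C (c i) * w * sFractionConvergent c (n + 1) i *
      sFractionConvergent c (n + 2) i, ?_⟩
    linear_combination (sFractionConvergent c (n + 1) i) * h₂ -
      (sFractionConvergent c (n + 2) i) * h₁ + PowerSeries.C (c i) * PowerSeries.X *
      sFractionConvergent c (n + 1) i * sFractionConvergent c (n + 2) i * hw

theorem coeff_sFractionConvergent_of_le (c : ℕ → R) {n N : ℕ} (h : n ≤ N) (i : ℕ) :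
    PowerSeries.coeff n (sFractionConvergent c N i) =
      PowerSeries.coeff n (sFractionConvergent c n i) := by
  induction N, h using Nat.le_induction with
  | base => rfl
  | succ N hN ih =>
    rw [← ih, ← sub_eq_zero, ← map_sub]
    exact PowerSeries.X_pow_dvd_iff.1 (sFractionConvergent_succ_sub_dvd c N i) n (by omega)

/-- The infinite continued fraction `1 / (1 - c_i t / (1 - c_{i+1} t / ⋯))`: its coefficient of
`t ^ n` is already that of the convergent of depth `n`. -/
noncomputable def sFractionTail (c : ℕ → R) (i : ℕ) : PowerSeries R :=
  PowerSeries.mk fun n => PowerSeries.coeff n (sFractionConvergent c n i)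

theorem X_pow_dvd_sFractionTail_sub (c : ℕ → R) (n i : ℕ) :
    (PowerSeries.X : PowerSeries R) ^ (n + 1) ∣
      sFractionTail c i - sFractionConvergent c n i := by
  refine PowerSeries.X_pow_dvd_iff.2 fun m hm => ?_
  rw [map_sub, sFractionTail, PowerSeries.coeff_mk,
    coeff_sFractionConvergent_of_le c (Nat.le_of_lt_succ hm), sub_self]

theorem PowerSeries.eq_zero_of_forall_X_pow_dvd {f : PowerSeries R}
    (h : ∀ n : ℕ, (PowerSeries.X : PowerSeries R) ^ n ∣ f) : f = 0 := by
  ext n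
  simpa using PowerSeries.X_pow_dvd_iff.1 (h (n + 1)) n (Nat.lt_succ_self n)

theorem sFractionTail_spec (c : ℕ → R) (i : ℕ) :
    (1 - PowerSeries.C (c i) * PowerSeries.X * sFractionTail c (i + 1)) *
      sFractionTail c i = 1 := by
  rw [← sub_eq_zero]
  refine PowerSeries.eq_zero_of_forall_X_pow_dvd fun n => ?_
  obtain ⟨w, hw⟩ := X_pow_dvd_sFractionTail_sub c n (i + 1)
  obtain ⟨z, hz⟩ := X_pow_dvd_sFractionTail_sub c (n + 1) i
  have h := sFractionConvergent_succ_spec c n i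
  refine ⟨(1 - PowerSeries.C (c i) * PowerSeries.X * sFractionConvergent c n (i + 1)) *
    PowerSeries.X ^ 2 * z
    - PowerSeries.C (c i) * PowerSeries.X ^ 2 * w * sFractionTail c i, ?_⟩
  linear_combination h + (1 - PowerSeries.C (c i) * PowerSeries.X *
    sFractionConvergent c n (i + 1)) * hz
    - PowerSeries.C (c i) * PowerSeries.X * sFractionTail c i * hw

theorem hasSFraction_iff_eq_tail {f : PowerSeries R} {c : ℕ → R} :
    HasSFraction f c ↔ f = sFractionTail c 1 := by
  constructor
  · intro h
    ext n
    obtain ⟨N, hN, hn⟩ := ((h n).and (Filter.eventually_ge_atTop n)).exists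
    rw [← hN, sFractionTail, PowerSeries.coeff_mk, coeff_sFractionConvergent_of_le c hn]
  · rintro rfl n
    filter_upwards [Filter.eventually_ge_atTop n] with N hn
    rw [sFractionTail, PowerSeries.coeff_mk, coeff_sFractionConvergent_of_le c hn]

theorem sFractionConvergent_congr {c d : ℕ → R} (h : ∀ i, 1 ≤ i → c i = d i) (n i : ℕ)
    (hi : 1 ≤ i) : sFractionConvergent c n i = sFractionConvergent d n i := by
  induction n generalizing i with
  | zero => rfl
  | succ n ih => rw [sFractionConvergent, sFractionConvergent, h i hi, ih (i + 1) (by omega)]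

theorem HasSFraction.congr {f : PowerSeries R} {c d : ℕ → R} (hf : HasSFraction f c)
    (h : ∀ i, 1 ≤ i → c i = d i) : HasSFraction f d := fun n =>
  (hf n).mono fun N hN => by rwa [← sFractionConvergent_congr h N 1 le_rfl]

theorem coeff_zero_sFractionTail (c : ℕ → R) (i : ℕ) :
    PowerSeries.coeff 0 (sFractionTail c i) = 1 := by
  simp [sFractionTail, sFractionConvergent]

theorem coeff_one_sFractionTail (c : ℕ → R) (i : ℕ) :
    PowerSeries.coeff 1 (sFractionTail c i) = c i := by
  have h := congrArg (PowerSeries.coeff 1) (sFractionTail_spec c i)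
  have h₁ := coeff_zero_sFractionTail c i
  have h₂ := coeff_zero_sFractionTail c (i + 1)
  have e : (1 - PowerSeries.C (c i) * PowerSeries.X * sFractionTail c (i + 1)) *
      sFractionTail c i = sFractionTail c i -
      PowerSeries.X * (PowerSeries.C (c i) * (sFractionTail c (i + 1) * sFractionTail c i)) := by
    ring
  rw [e, map_sub, show (1 : ℕ) = 0 + 1 from rfl, PowerSeries.coeff_succ_X_mul,
    PowerSeries.coeff_C_mul, PowerSeries.coeff_zero_mul, h₁, h₂, PowerSeries.coeff_one] at h
  simpa [sub_eq_zero] using h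

end Tails

/-! ### Riccati equations for the tails -/

section Riccati
variable {R : Type*} [CommRing R]

/-- The operator `∂/∂x` on `R[x][[t]]`, acting on each coefficient. -/
noncomputable def coeffDerivative (f : PowerSeries R[X]) : PowerSeries R[X] :=
  PowerSeries.mk fun n => derivative (PowerSeries.coeff n f)

@[simp]
theorem coeff_coeffDerivative (f : PowerSeries R[X]) (n : ℕ) :
    PowerSeries.coeff n (coeffDerivative f) = derivative (PowerSeries.coeff n f) :=
  PowerSeries.coeff_mk _ _

theorem coeffDerivative_mul (f g : PowerSeries R[X]) :
    coeffDerivative (f * g) = coeffDerivative f * g + f * coeffDerivative g := by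
  ext1 n
  simp only [coeff_coeffDerivative, map_add, PowerSeries.coeff_mul, map_sum, derivative_mul,
    Finset.sum_add_distrib]

theorem coeffDerivative_sub (f g : PowerSeries R[X]) :
    coeffDerivative (f - g) = coeffDerivative f - coeffDerivative g := by
  ext1 n
  simp

theorem coeffDerivative_one : coeffDerivative (1 : PowerSeries R[X]) = 0 := by
  ext1 n
  rw [coeff_coeffDerivative, PowerSeries.coeff_one]
  split_ifs <;> simp

theorem coeffDerivative_C (p : R[X]) :
    coeffDerivative (PowerSeries.C p) = PowerSeries.C (derivative p) := by
  ext1 n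
  rw [coeff_coeffDerivative, PowerSeries.coeff_C, PowerSeries.coeff_C]
  split_ifs <;> simp

theorem coeffDerivative_X : coeffDerivative (PowerSeries.X : PowerSeries R[X]) = 0 := by
  ext1 n
  rw [coeff_coeffDerivative, PowerSeries.coeff_X]
  split_ifs <;> simp

/-- The first-order operator `t² u ∂/∂t + t v ∂/∂x` on `R[x][[t]]`. -/
noncomputable def firstOrderOp (u v : R[X]) (f : PowerSeries R[X]) : PowerSeries R[X] :=
  PowerSeries.X ^ 2 * (PowerSeries.C u * PowerSeries.derivative R[X] f) +
    PowerSeries.X * (PowerSeries.C v * coeffDerivative f)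

variable (u v : R[X])

theorem firstOrderOp_mul (f g : PowerSeries R[X]) :
    firstOrderOp u v (f * g) = firstOrderOp u v f * g + f * firstOrderOp u v g := by
  simp only [firstOrderOp, coeffDerivative_mul, Derivation.leibniz, smul_eq_mul]
  ring

theorem firstOrderOp_sub (f g : PowerSeries R[X]) :
    firstOrderOp u v (f - g) = firstOrderOp u v f - firstOrderOp u v g := by
  simp only [firstOrderOp, coeffDerivative_sub, map_sub]
  ring

theorem firstOrderOp_one : firstOrderOp u v 1 = 0 := by
  simp [firstOrderOp, coeffDerivative_one]

theorem firstOrderOp_C_mul_X (c : R[X]) :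
    firstOrderOp u v (PowerSeries.C c * PowerSeries.X) =
      PowerSeries.X ^ 2 * PowerSeries.C (c * u + v * derivative c) := by
  simp only [firstOrderOp, coeffDerivative_mul, Derivation.leibniz, smul_eq_mul,
    coeffDerivative_X, coeffDerivative_C, PowerSeries.derivative_C, PowerSeries.derivative_X,
    map_add, map_mul]
  ring

theorem coeff_zero_firstOrderOp (f : PowerSeries R[X]) :
    PowerSeries.coeff 0 (firstOrderOp u v f) = 0 := by
  simp [firstOrderOp]

theorem coeff_succ_firstOrderOp (f : PowerSeries R[X]) (n : ℕ) :
    PowerSeries.coeff (n + 1) (firstOrderOp u v f) =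
      (n : R[X]) * u * PowerSeries.coeff n f + v * derivative (PowerSeries.coeff n f) := by
  rw [firstOrderOp, map_add, pow_two, mul_assoc, PowerSeries.coeff_succ_X_mul,
    PowerSeries.coeff_succ_X_mul, PowerSeries.coeff_C_mul, coeff_coeffDerivative]
  congr 1
  cases n with
  | zero => simp
  | succ n =>
    rw [PowerSeries.coeff_succ_X_mul, PowerSeries.coeff_C_mul, PowerSeries.coeff_derivative]
    push_cast
    ring

/-- The defect of `g` in the Riccati equation
`(t² u ∂/∂t + t v ∂/∂x) g = -1 + (1 + t (p - c)) g - p t g²`. -/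
noncomputable def riccatiDefect (p c : R[X]) (g : PowerSeries R[X]) : PowerSeries R[X] :=
  firstOrderOp u v g + 1 - (1 + PowerSeries.X * PowerSeries.C (p - c)) * g +
    PowerSeries.C p * PowerSeries.X * g ^ 2

/-- Riccati equations are stable under the substitution `g = 1 / (1 - c t h)`; the only
obstruction to the equation for `h` is the polynomial `c (p + u - e) + v c'`. -/
theorem riccatiDefect_eq (p c e : R[X]) {g h : PowerSeries R[X]}
    (hg : (1 - PowerSeries.C c * PowerSeries.X * h) * g = 1) :
    riccatiDefect u v p c g = g ^ 2 * PowerSeries.X *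
      (PowerSeries.C c * riccatiDefect u v c e h +
        PowerSeries.X * h * PowerSeries.C (c * (p + u - e) + v * derivative c)) := by
  have hD := congrArg (firstOrderOp u v) hg
  rw [firstOrderOp_mul, firstOrderOp_sub, firstOrderOp_one, firstOrderOp_mul,
    firstOrderOp_C_mul_X] at hD
  have hDg : firstOrderOp u v g = g ^ 2 * (PowerSeries.X ^ 2 *
      PowerSeries.C (c * u + v * derivative c) * h +
        PowerSeries.C c * PowerSeries.X * firstOrderOp u v h) := by
    linear_combination g * hD - firstOrderOp u v g * hg
  rw [riccatiDefect, riccatiDefect, hDg]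
  simp only [map_add, map_mul, map_sub]
  generalize PowerSeries.C c = C₁ at *
  generalize PowerSeries.C p = P at *
  generalize (PowerSeries.X : PowerSeries R[X]) = t at *
  generalize PowerSeries.C u = U at *
  generalize PowerSeries.C v = V at *
  generalize PowerSeries.C e = E at *
  generalize PowerSeries.C (derivative c) = C' at *
  generalize firstOrderOp u v h = Dh at *
  linear_combination ((-1 : PowerSeries R[X]) - (1 - C₁ * t * h) * g + (1 + t * (P - C₁)) * g) * hg

/-- For `p = 0` the Riccati equation is linear, and amounts to a recurrence that determines the
coefficients of `f`. -/
theorem riccatiDefect_zero_left_eq_zero_iff (q : R[X]) (f : PowerSeries R[X]) :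
    riccatiDefect u v 0 q f = 0 ↔ PowerSeries.coeff 0 f = 1 ∧ ∀ n, PowerSeries.coeff (n + 1) f =
      (q + (n : R[X]) * u) * PowerSeries.coeff n f +
        v * derivative (PowerSeries.coeff n f) := by
  have e : riccatiDefect u v 0 q f = firstOrderOp u v f + 1 - f +
      PowerSeries.X * (PowerSeries.C q * f) := by
    simp only [riccatiDefect, map_zero, zero_sub, map_neg]
    ring
  have h₀ : PowerSeries.coeff 0 (riccatiDefect u v 0 q f) = 1 - PowerSeries.coeff 0 f := by
    rw [e, map_add, map_sub, map_add, coeff_zero_firstOrderOp, PowerSeries.coeff_zero_X_mul]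
    simp
  have h₁ (n : ℕ) : PowerSeries.coeff (n + 1) (riccatiDefect u v 0 q f) =
      (q + (n : R[X]) * u) * PowerSeries.coeff n f + v * derivative (PowerSeries.coeff n f) -
        PowerSeries.coeff (n + 1) f := by
    rw [e, map_add, map_sub, map_add, coeff_succ_firstOrderOp, PowerSeries.coeff_succ_X_mul,
      PowerSeries.coeff_C_mul, PowerSeries.coeff_one, if_neg n.succ_ne_zero]
    ring
  constructor
  · intro h
    rw [h, map_zero] at h₀
    refine ⟨(sub_eq_zero.1 h₀.symm).symm, fun n => ?_⟩
    have := h₁ n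
    rw [h, map_zero] at this
    exact (sub_eq_zero.1 this.symm).symm
  · rintro ⟨h, h'⟩
    ext1 n
    cases n with
    | zero => rw [h₀, h, sub_self, map_zero]
    | succ n => rw [h₁, h' n, sub_self, map_zero]

/-- The tails of an S-fraction satisfy their Riccati equations up to order `t²`, whatever the
coefficients are. -/
theorem coeff_one_riccatiDefect_tail (p : R[X]) (c : ℕ → R[X]) (i : ℕ) :
    PowerSeries.coeff 1 (riccatiDefect u v p (c i) (sFractionTail c i)) = 0 := by
  have h₀ := coeff_zero_sFractionTail c i
  have e : riccatiDefect u v p (c i) (sFractionTail c i) =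
      firstOrderOp u v (sFractionTail c i) + 1 - sFractionTail c i -
      PowerSeries.X * (PowerSeries.C (p - c i) * sFractionTail c i) +
      PowerSeries.X * (PowerSeries.C p * (sFractionTail c i * sFractionTail c i)) := by
    simp only [riccatiDefect]
    ring
  have hd := coeff_succ_firstOrderOp u v (sFractionTail c i) 0
  rw [zero_add] at hd
  have hx (f : PowerSeries R[X]) : PowerSeries.coeff 1 (PowerSeries.X * f) =
      PowerSeries.coeff 0 f := PowerSeries.coeff_succ_X_mul 0 f
  rw [e, map_add, map_sub, map_sub, map_add, hx, hx, hd, coeff_one_sFractionTail,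
    PowerSeries.coeff_C_mul, PowerSeries.coeff_C_mul, PowerSeries.coeff_zero_mul, h₀,
    PowerSeries.coeff_one]
  simp only [one_ne_zero, if_false, Polynomial.derivative_one]
  ring

/-- Polynomials satisfying the recurrence make every tail a solution of its Riccati equation:
each defect is `t` times a multiple of the following one, hence divisible by all powers of `t`. -/
theorem riccatiDefect_tail_eq_zero {c : ℕ → R[X]}
    (hc : ∀ i, c (i + 1) * (c (i + 2) - c i - u) = v * derivative (c (i + 1))) (i : ℕ) :
    riccatiDefect u v (c i) (c (i + 1)) (sFractionTail c (i + 1)) = 0 := by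
  refine PowerSeries.eq_zero_of_forall_X_pow_dvd fun n => ?_
  induction n generalizing i with
  | zero => exact ⟨_, by rw [pow_zero, one_mul]⟩
  | succ n ih =>
    obtain ⟨w, hw⟩ := ih (i + 1)
    have h0 : c (i + 1) * (c i + u - c (i + 2)) + v * derivative (c (i + 1)) = 0 := by
      linear_combination -hc i
    rw [riccatiDefect_eq u v (c i) (c (i + 1)) (c (i + 2)) (sFractionTail_spec c (i + 1)), h0,
      hw, map_zero, mul_zero, add_zero]
    exact ⟨sFractionTail c (i + 1) ^ 2 * PowerSeries.C (c (i + 1)) * w, by ring⟩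

/-- Conversely, a Riccati equation for the first tail propagates to all tails when no coefficient
vanishes, and forces the recurrence. -/
theorem sFraction_recurrence [IsDomain R] {c : ℕ → R[X]} (hne : ∀ i, 1 ≤ i → c i ≠ 0)
    (h : riccatiDefect u v (c 0) (c 1) (sFractionTail c 1) = 0) (i : ℕ) :
    c (i + 1) * (c (i + 2) - c i - u) = v * derivative (c (i + 1)) := by
  have hstep (i : ℕ) (h : riccatiDefect u v (c i) (c (i + 1)) (sFractionTail c (i + 1)) = 0) :
      c (i + 1) * (c i + u - c (i + 2)) + v * derivative (c (i + 1)) = 0 ∧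
      riccatiDefect u v (c (i + 1)) (c (i + 2)) (sFractionTail c (i + 2)) = 0 := by
    rw [riccatiDefect_eq u v (c i) (c (i + 1)) (c (i + 2)) (sFractionTail_spec c (i + 1))] at h
    have hg : sFractionTail c (i + 1) ≠ 0 := by
      intro h0
      have := coeff_zero_sFractionTail c (i + 1)
      simp [h0] at this
    have h2 := (mul_eq_zero.1 h).resolve_left
      (mul_ne_zero (pow_ne_zero 2 hg) PowerSeries.X_ne_zero)
    have h3 := congrArg (PowerSeries.coeff 1) h2
    rw [map_add, PowerSeries.coeff_C_mul, coeff_one_riccatiDefect_tail, mul_assoc,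
      show (1 : ℕ) = 0 + 1 from rfl, PowerSeries.coeff_succ_X_mul, PowerSeries.coeff_mul_C] at h3
    have h4 : c (i + 1) * (c i + u - c (i + 2)) + v * derivative (c (i + 1)) = 0 := by
      simpa [coeff_zero_sFractionTail] using h3
    refine ⟨h4, ?_⟩
    rw [h4, map_zero, mul_zero, add_zero] at h2
    refine (mul_eq_zero.1 h2).resolve_left fun h5 => hne (i + 1) (by omega) ?_
    simpa using congrArg (PowerSeries.coeff 0) h5
  have hall (i : ℕ) : riccatiDefect u v (c i) (c (i + 1)) (sFractionTail c (i + 1)) = 0 := by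
    induction i with
    | zero => exact h
    | succ i ih => exact (hstep i ih).2
  linear_combination -(hstep i (hall i)).1

end Riccati

/-! ### The recurrence on constant and linear coefficients -/

/-- The relation between three consecutive coefficients `a₀ + b₀ x`, `a + b x ≠ 0`, `a₂ + b₂ x`
expressed by `(a + b x) (a₂ + b₂ x - a₀ - b₀ x - u) = v b`, where `u = p + (r - β') x` and
`v = x (β + β' x)`, split according to whether `a + b x` has two terms (and is then proportional
to `β + β' x`, unless `v = 0`), is a multiple of `x`, or is constant. In the parameters `p = α` and
`r = α' + β'` the relation is symmetric under reversal of polynomials. -/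
def CoeffStep (p r β β' a₀ b₀ a b a₂ b₂ : ℂ) : Prop :=
  (a ≠ 0 ∧ b ≠ 0 ∧ a₂ = a₀ + p ∧ b₂ = b₀ + r ∧ a * β' = b * β) ∨
    (a = 0 ∧ b ≠ 0 ∧ a₂ = a₀ + p + β ∧ b₂ = b₀ + r) ∨
    (a ≠ 0 ∧ b = 0 ∧ a₂ = a₀ + p ∧ b₂ = b₀ + r - β')

namespace CoeffStep
variable {p r β β' a₀ b₀ a b a₂ b₂ : ℂ}

theorem of_coeff_eq (h0 : a * (a₂ - a₀ - p) = 0)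
    (h1 : a * (b₂ - b₀ - (r - β')) + b * (a₂ - a₀ - p) = b * β)
    (h2 : b * (b₂ - b₀ - (r - β')) = b * β') (hne : a ≠ 0 ∨ b ≠ 0) :
    CoeffStep p r β β' a₀ b₀ a b a₂ b₂ := by
  unfold CoeffStep
  grind

theorem swap (h : CoeffStep p r β β' a₀ b₀ a b a₂ b₂) :
    CoeffStep r p (-β') (-β) b₀ a₀ b a b₂ a₂ := by
  unfold CoeffStep at *
  grind

/-- Rescaling constant terms by `β` and linear coefficients by `β'` normalizes `β = β' = 1`. -/
theorem scale (hβ : β ≠ 0) (hβ' : β' ≠ 0) (h : CoeffStep p r β β' a₀ b₀ a b a₂ b₂) :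
    CoeffStep (p / β) (r / β') 1 1 (a₀ / β) (b₀ / β') (a / β) (b / β') (a₂ / β) (b₂ / β') := by
  unfold CoeffStep at *
  rcases h with ⟨h1, h2, rfl, rfl, h5⟩ | ⟨rfl, h2, rfl, rfl⟩ | ⟨h1, rfl, rfl, rfl⟩
  · refine Or.inl ⟨div_ne_zero h1 hβ, div_ne_zero h2 hβ', add_div .., add_div .., ?_⟩
    field_simp
    linear_combination h5
  · refine Or.inr (Or.inl ⟨zero_div _, div_ne_zero h2 hβ', ?_, add_div ..⟩)
    field_simp
  · refine Or.inr (Or.inr ⟨div_ne_zero h1 hβ, zero_div _, add_div .., ?_⟩)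
    field_simp

end CoeffStep

/-! ### Classification of the solutions of the recurrence -/

section Classification
variable {a b : ℕ → ℂ} {p r β β' : ℂ}

/-- In the normalization `β = β' = 1`, the shapes of the first six coefficients leave finitely many
systems of linear conditions on `p`, `r` and the linear coefficient `b 1`. -/
theorem classification_mul_X_one (ha : a 0 = 0) (hb : b 0 = 0)
    (hs : ∀ i, CoeffStep p r 1 1 (a i) (b i) (a (i + 1)) (b (i + 1)) (a (i + 2)) (b (i + 2)))
    (h : a 1 = 0) : (p = 0 ∧ r = 0) ∨ p + 1 = 0 ∨ (p = 0 ∧ r = 1) := by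
  have h₀ := hs 0
  have h₁ := hs 1
  have h₂ := hs 2
  have h₃ := hs 3
  have h₄ := hs 4
  have h₅ := hs 5
  clear hs
  simp only [CoeffStep, zero_add, Nat.reduceAdd, mul_one, ha, hb] at h₀ h₁ h₂ h₃ h₄ h₅
  grind (splits := 30)

/-- The normalized case in which the first coefficient has two terms; again six coefficients
suffice. -/
theorem classification_two_terms_one (ha : a 0 = 0) (hb : b 0 = 0)
    (hs : ∀ i, CoeffStep p r 1 1 (a i) (b i) (a (i + 1)) (b (i + 1)) (a (i + 2)) (b (i + 2)))
    (h : a 1 ≠ 0) (h' : b 1 ≠ 0) : p = r ∨ (p = 0 ∧ r = 1) ∨ (r = 0 ∧ p + 1 = 0) := by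
  have h₀ := hs 0
  have h₁ := hs 1
  have h₂ := hs 2
  have h₃ := hs 3
  have h₄ := hs 4
  have h₅ := hs 5
  clear hs
  simp only [CoeffStep, zero_add, Nat.reduceAdd, mul_one, ha, hb] at h₀ h₁ h₂ h₃ h₄ h₅
  grind (splits := 30)

/-- If `c 1` is a multiple of `x`, the parameters are those of family 1a, 2a or 3a. -/
theorem classification_mul_X (hβ : β ≠ 0 ∨ β' ≠ 0) (ha : a 0 = 0) (hb : b 0 = 0)
    (hs : ∀ i, CoeffStep p r β β' (a i) (b i) (a (i + 1)) (b (i + 1)) (a (i + 2)) (b (i + 2)))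
    (h : a 1 = 0) : (p = 0 ∧ r = 0) ∨ p + β = 0 ∨ (p = 0 ∧ r = β') := by
  by_cases hββ : β = 0 ∨ β' = 0
  · -- Exactly one of `β`, `β'` vanishes, so no coefficient has two terms.
    have hs' (i : ℕ) :
        (a (i + 1) = 0 ∧ b (i + 1) ≠ 0 ∧ a (i + 2) = a i + p + β ∧ b (i + 2) = b i + r) ∨
        (a (i + 1) ≠ 0 ∧ b (i + 1) = 0 ∧ a (i + 2) = a i + p ∧ b (i + 2) = b i + r - β') :=
      (hs i).resolve_left fun ⟨h1, h2, _, _, h5⟩ => by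
        rcases hββ with rfl | rfl <;> simp_all
    have h₀ := hs' 0
    have h₁ := hs' 1
    have h₂ := hs' 2
    have h₃ := hs' 3
    clear hs hs'
    simp only [zero_add, Nat.reduceAdd, ha, hb] at h₀ h₁ h₂ h₃
    grind (splits := 30)
  · obtain ⟨h1, h2⟩ := not_or.1 hββ
    have := classification_mul_X_one (a := fun i => a i / β) (b := fun i => b i / β')
      (by simp [ha]) (by simp [hb]) (fun i => (hs i).scale h1 h2) (by simp [h])
    field_simp at this
    simpa using this

/-- If `c 1` is constant, the parameters are those of family 1b, 2b or 3b, by reversal of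
polynomials. -/
theorem classification_const (hβ : β ≠ 0 ∨ β' ≠ 0) (ha : a 0 = 0) (hb : b 0 = 0)
    (hs : ∀ i, CoeffStep p r β β' (a i) (b i) (a (i + 1)) (b (i + 1)) (a (i + 2)) (b (i + 2)))
    (h : b 1 = 0) : (p = 0 ∧ r = 0) ∨ r = β' ∨ (r = 0 ∧ p + β = 0) := by
  have := classification_mul_X (a := b) (b := a) (β := -β') (β' := -β)
    (by simpa using hβ.symm) hb ha (fun i => (hs i).swap) h
  grind

/-- If `c 1` has two terms, the parameters are those of family 6, 4a or 4b. -/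
theorem classification_two_terms (hβ : β ≠ 0 ∨ β' ≠ 0) (ha : a 0 = 0) (hb : b 0 = 0)
    (hs : ∀ i, CoeffStep p r β β' (a i) (b i) (a (i + 1)) (b (i + 1)) (a (i + 2)) (b (i + 2)))
    (h : a 1 ≠ 0) (h' : b 1 ≠ 0) :
    β' ≠ 0 ∧ a 1 * β' = b 1 * β ∧
      (p * β' = r * β ∨ (p = 0 ∧ r = β') ∨ (r = 0 ∧ p + β = 0)) := by
  have h5 : a 1 * β' = b 1 * β := by
    rcases hs 0 with ⟨_, _, _, _, h5⟩ | ⟨h1, _⟩ | ⟨_, h2, _⟩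
    exacts [h5, absurd h1 h, absurd h2 h']
  have h1 : β ≠ 0 := by rintro rfl; simp_all
  have h2 : β' ≠ 0 := by rintro rfl; simp_all
  have := classification_two_terms_one (a := fun i => a i / β) (b := fun i => b i / β')
    (by simp [ha]) (by simp [hb]) (fun i => (hs i).scale h1 h2) (div_ne_zero h h1)
    (div_ne_zero h' h2)
  refine ⟨h2, h5, ?_⟩
  rw [div_eq_div_iff h1 h2, div_eq_zero_iff, div_eq_zero_iff, div_eq_one_iff_eq h2,
    or_iff_left h1, or_iff_left h2] at this
  refine this.imp_right (Or.imp_right (And.imp_right fun e => ?_))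
  rw [div_add_one h1, div_eq_zero_iff] at e
  exact e.resolve_right h1

end Classification

/-! ### Degree bound -/

/-- Polynomial solutions of the recurrence have degree at most one: `v c' / c` has degree at most
`deg v - 1` as soon as it is a polynomial. -/
theorem natDegree_le_one_of_recurrence {u v : ℂ[X]} (hu : u.natDegree ≤ 1) (hv : v.natDegree ≤ 2)
    {p c e : ℂ[X]} (hp : p.natDegree ≤ 1) (hc : c ≠ 0) (h : c * (e - p - u) = v * derivative c) :
    e.natDegree ≤ 1 := by
  have hw : (e - p - u).natDegree ≤ 1 := by
    by_cases hw : e - p - u = 0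
    · simp [hw]
    have hd : derivative c ≠ 0 := by
      intro hd
      rw [hd, mul_zero] at h
      exact (mul_ne_zero hc hw) h
    have h₀ : c.natDegree ≠ 0 := fun h₀ => hd (derivative_of_natDegree_zero h₀)
    have h₁ := congrArg natDegree h
    rw [natDegree_mul hc hw] at h₁
    have h₂ := natDegree_mul_le (p := v) (q := derivative c)
    have h₃ := natDegree_derivative_le c
    omega
  have : e = (e - p - u) + p + u := by ring
  rw [this]
  exact natDegree_add_le_of_degree_le (natDegree_add_le_of_degree_le hw hp) hu


/-! ### The Graham–Knuth–Patashnik generating function -/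

namespace GKPParam
variable (μ : GKPParam)

theorem T_of_lt (n : ℕ) (k : ℤ) (h : (n : ℤ) < k) : μ.T n k = 0 := by
  induction n generalizing k with
  | zero => simp only [T]; rw [if_neg (by simpa using h.ne')]
  | succ n ih => rw [T, ih k (by push_cast at h; omega), ih (k - 1) (by push_cast at h; omega)]; simp

theorem T_of_neg (n : ℕ) (k : ℤ) (h : k < 0) : μ.T n k = 0 := by
  induction n generalizing k with
  | zero => simp only [T]; rw [if_neg h.ne]
  | succ n ih => rw [T, ih k h, ih (k - 1) (by omega)]; simp

theorem coeff_rowPoly (n k : ℕ) : (μ.rowPoly n).coeff k = μ.T n k := by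
  simp only [rowPoly, finsetSum_coeff, coeff_C_mul_X_pow]
  rw [Finset.sum_ite_eq]
  split_ifs with h
  · rfl
  · exact (μ.T_of_lt n k (by simp at h; omega)).symm

/-- The polynomial `u = α + α' x`. -/
noncomputable def tCoeff : ℂ[X] := C μ.α + C μ.α' * X

/-- The polynomial `v = β x + β' x²`. -/
noncomputable def xCoeff : ℂ[X] := C μ.β * X + C μ.β' * X ^ 2

/-- The polynomial `q = (α + γ) + (α' + β' + γ') x`, equal to the first row polynomial. -/
noncomputable def firstCoeff : ℂ[X] := C (μ.α + μ.γ) + C (μ.α' + μ.β' + μ.γ') * X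

theorem rowPoly_zero : μ.rowPoly 0 = 1 := by simp [rowPoly, T]

theorem rowPoly_succ (n : ℕ) : μ.rowPoly (n + 1) =
    (μ.firstCoeff + (n : ℂ[X]) * μ.tCoeff) * μ.rowPoly n +
      μ.xCoeff * derivative (μ.rowPoly n) := by
  have e : (μ.firstCoeff + (n : ℂ[X]) * μ.tCoeff) * μ.rowPoly n +
      μ.xCoeff * derivative (μ.rowPoly n) =
      C (μ.α + μ.γ + n * μ.α) * μ.rowPoly n +
      C (μ.α' + μ.β' + μ.γ' + n * μ.α') * (μ.rowPoly n * X) +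
      C μ.β * (derivative (μ.rowPoly n) * X) + C μ.β' * (derivative (μ.rowPoly n) * X * X) := by
    simp only [firstCoeff, tCoeff, xCoeff, map_add, map_mul, map_natCast]
    ring
  rw [e]
  ext k
  rw [coeff_rowPoly]
  simp only [coeff_add, coeff_C_mul]
  rcases k with _ | _ | k
  · simp only [mul_coeff_zero, coeff_X_zero, mul_zero, coeff_rowPoly, T]
    rw [μ.T_of_neg n (((0 : ℕ) : ℤ) - 1) (by simp)]
    push_cast
    ring
  · simp only [coeff_mul_X, mul_coeff_zero, coeff_X_zero, mul_zero, coeff_rowPoly, T,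
      coeff_derivative]
    rw [show ((0 + 1 : ℕ) : ℤ) - 1 = ((0 : ℕ) : ℤ) by simp]
    push_cast
    ring
  · simp only [coeff_mul_X, coeff_rowPoly, T, coeff_derivative]
    push_cast
    rw [show (k : ℤ) + 1 + 1 - 1 = k + 1 by ring]
    ring

/-- The recurrence of the row polynomials says that the generating function solves the linear
equation `(t² u ∂/∂t + t v ∂/∂x) f = -1 + (1 - t q) f`. -/
theorem riccatiDefect_ogf : riccatiDefect μ.tCoeff μ.xCoeff 0 μ.firstCoeff μ.ogf = 0 := by
  rw [riccatiDefect_zero_left_eq_zero_iff]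
  simp only [ogf, PowerSeries.coeff_mk]
  exact ⟨μ.rowPoly_zero, μ.rowPoly_succ⟩

theorem eq_ogf_of_riccatiDefect_eq_zero {f : PowerSeries ℂ[X]}
    (h : riccatiDefect μ.tCoeff μ.xCoeff 0 μ.firstCoeff f = 0) : f = μ.ogf := by
  rw [riccatiDefect_zero_left_eq_zero_iff] at h
  ext1 n
  rw [ogf, PowerSeries.coeff_mk]
  induction n with
  | zero => rw [h.1, rowPoly_zero]
  | succ n ih => rw [h.2, ih, rowPoly_succ]

/-! ### The recurrence for the S-fraction coefficients of the generating function -/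

/-- A polynomial solution of the recurrence, possibly with vanishing terms, gives an S-fraction. -/
theorem hasSFraction_of_recurrence {c : ℕ → ℂ[X]} (h0 : c 0 = 0) (h1 : c 1 = μ.firstCoeff)
    (hc : ∀ i, c (i + 1) * (c (i + 2) - c i - μ.tCoeff) = μ.xCoeff * derivative (c (i + 1))) :
    HasSFraction μ.ogf c := by
  have h := riccatiDefect_tail_eq_zero _ _ hc 0
  rw [h0, zero_add, h1] at h
  exact hasSFraction_iff_eq_tail.2 (μ.eq_ogf_of_riccatiDefect_eq_zero h).symm

theorem recurrence_of_hasSFraction {c : ℕ → ℂ[X]} (h0 : c 0 = 0) (hne : ∀ i, 1 ≤ i → c i ≠ 0)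
    (h : HasSFraction μ.ogf c) :
    c 1 = μ.firstCoeff ∧
      ∀ i, c (i + 1) * (c (i + 2) - c i - μ.tCoeff) = μ.xCoeff * derivative (c (i + 1)) := by
  rw [hasSFraction_iff_eq_tail] at h
  have hR := μ.riccatiDefect_ogf
  have h1 : c 1 = μ.firstCoeff := by
    rw [← coeff_one_sFractionTail c 1, ← h, ogf, PowerSeries.coeff_mk, rowPoly_succ, rowPoly_zero]
    simp
  refine ⟨h1, sFraction_recurrence _ _ hne ?_⟩
  rw [h0, h1, ← h, hR]

/-- In all ten families the coefficients of even and of odd index form arithmetic progressions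
`k U` and `q + k W`, and the recurrence reduces to three identities. -/
theorem exists_hasSFraction_of_progressions (U W : ℂ[X])
    (h₁ : μ.firstCoeff * (U - μ.tCoeff) = μ.xCoeff * derivative μ.firstCoeff)
    (h₂ : W * (U - μ.tCoeff) = μ.xCoeff * derivative W)
    (h₃ : U * (W - μ.tCoeff) = μ.xCoeff * derivative U) :
    ∃ c : ℕ → ℂ[X], HasSFraction μ.ogf c := by
  let c : ℕ → ℂ[X] := fun i =>
    if Even i then ((i / 2 : ℕ) : ℂ[X]) * U else μ.firstCoeff + ((i / 2 : ℕ) : ℂ[X]) * W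
  have he (k : ℕ) : c (2 * k) = (k : ℂ[X]) * U := by simp [c]
  have ho (k : ℕ) : c (2 * k + 1) = μ.firstCoeff + (k : ℂ[X]) * W := by
    have : (2 * k + 1) / 2 = k := by omega
    simp [c, this]
  refine ⟨c, μ.hasSFraction_of_recurrence (by simp [c]) (by simp [c]) fun i => ?_⟩
  obtain ⟨k, rfl | rfl⟩ := Nat.even_or_odd' i
  · rw [ho, he, show 2 * k + 2 = 2 * (k + 1) by ring, he]
    simp only [derivative_add, derivative_mul, derivative_natCast]
    push_cast
    linear_combination h₁ + (k : ℂ[X]) * h₂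
  · rw [show 2 * k + 1 + 1 = 2 * (k + 1) by ring, show 2 * k + 1 + 2 = 2 * (k + 1) + 1 by ring,
      ho, ho, he]
    simp only [derivative_mul, derivative_natCast]
    push_cast
    linear_combination ((k : ℂ[X]) + 1) * h₃

/-! ### The ten families -/

theorem exists_hasSFraction_of_mem_families (h : μ ∈ families) :
    ∃ c : ℕ → ℂ[X], HasSFraction μ.ogf c := by
  rcases h with ((((((((h | h) | h) | h) | h) | h) | h) | h) | h) | h
  case inl.inl.inl.inl.inl.inl.inl.inl.inl =>
    obtain ⟨β, α', γ', rfl⟩ := h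
    apply exists_hasSFraction_of_progressions _ (C β) (C α' * X) <;>
      simp [tCoeff, xCoeff, firstCoeff] <;> ring
  case inl.inl.inl.inl.inl.inl.inl.inl.inr =>
    obtain ⟨β, γ, α', rfl⟩ := h
    apply exists_hasSFraction_of_progressions _ (C α' * X) (C β) <;>
      simp [tCoeff, xCoeff, firstCoeff]
    ring
  case inl.inl.inl.inl.inl.inl.inl.inr =>
    obtain ⟨α, α', β', γ', rfl⟩ := h
    apply exists_hasSFraction_of_progressions _ (C (α' + β') * X) (C (α' + β') * X) <;>
      simp [tCoeff, xCoeff, firstCoeff] <;> ring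
  case inl.inl.inl.inl.inl.inl.inr =>
    obtain ⟨α, β, γ, β', rfl⟩ := h
    apply exists_hasSFraction_of_progressions _ (C α) (C α) <;>
      simp [tCoeff, xCoeff, firstCoeff]
  case inl.inl.inl.inl.inl.inr =>
    obtain ⟨β, β', γ', rfl⟩ := h
    apply exists_hasSFraction_of_progressions _ (C β + C β' * X) (C β' * X) <;>
      simp [tCoeff, xCoeff, firstCoeff] <;> ring
  case inl.inl.inl.inl.inr =>
    obtain ⟨α, γ, α', rfl⟩ := h
    apply exists_hasSFraction_of_progressions _ (C α + C α' * X) (C α) <;>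
      simp [tCoeff, xCoeff, firstCoeff]
    ring
  case inl.inl.inl.inr =>
    obtain ⟨κ, β', γ', rfl⟩ := h
    apply exists_hasSFraction_of_progressions _ (C β' * X) (C β' * (C κ + X)) <;>
      simp [tCoeff, xCoeff, firstCoeff] <;> ring
  case inl.inl.inr =>
    obtain ⟨κ, α, γ, rfl⟩ := h
    apply exists_hasSFraction_of_progressions _ (C α) (C α * (1 + C κ * X)) <;>
      simp only [tCoeff, xCoeff, firstCoeff, map_add, map_neg, map_mul, derivative_mul,
        derivative_C, derivative_X, derivative_one] <;> ring
  case inl.inr =>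
    obtain ⟨α, γ, α', γ', rfl⟩ := h
    apply exists_hasSFraction_of_progressions _ (C α + C α' * X) (C α + C α' * X) <;>
      simp [tCoeff, xCoeff, firstCoeff]
  case inr =>
    obtain ⟨κ, α', β', γ', rfl⟩ := h
    apply exists_hasSFraction_of_progressions _ (C (α' + β') * (C κ + X))
      (C (α' + β') * (C κ + X)) <;>
      simp [tCoeff, xCoeff, firstCoeff] <;> ring

theorem mem_families_of_recurrence {c : ℕ → ℂ[X]} (h0 : c 0 = 0) (h1 : c 1 = μ.firstCoeff)
    (hne : ∀ i, 1 ≤ i → c i ≠ 0)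
    (hc : ∀ i, c (i + 1) * (c (i + 2) - c i - μ.tCoeff) = μ.xCoeff * derivative (c (i + 1))) :
    μ ∈ families := by
  have hu : μ.tCoeff.natDegree ≤ 1 := by unfold tCoeff; compute_degree
  have hv : μ.xCoeff.natDegree ≤ 2 := by unfold xCoeff; compute_degree
  have hq : μ.firstCoeff.natDegree ≤ 1 := by unfold firstCoeff; compute_degree
  have hdeg (i : ℕ) : (c i).natDegree ≤ 1 := by
    induction i using Nat.twoStepInduction with
    | zero => simp [h0]
    | one => rwa [h1]
    | more i hi _ => exact natDegree_le_one_of_recurrence hu hv hi (hne _ (by omega)) (hc i)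
  have hlin (i : ℕ) : c i = C ((c i).coeff 1) * X + C ((c i).coeff 0) :=
    eq_X_add_C_of_natDegree_le_one (hdeg i)
  have hs (i : ℕ) : CoeffStep μ.α (μ.α' + μ.β') μ.β μ.β' ((c i).coeff 0) ((c i).coeff 1)
      ((c (i + 1)).coeff 0) ((c (i + 1)).coeff 1) ((c (i + 2)).coeff 0) ((c (i + 2)).coeff 1) := by
    have h := hc i
    have hn : (c (i + 1)).coeff 0 ≠ 0 ∨ (c (i + 1)).coeff 1 ≠ 0 := by
      by_contra! hn
      refine hne (i + 1) (by omega) ?_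
      rw [hlin (i + 1), hn.1, hn.2]
      simp
    rw [hlin i, hlin (i + 1), hlin (i + 2)] at h
    generalize (c i).coeff 0 = a₀ at *
    generalize (c i).coeff 1 = b₀ at *
    generalize (c (i + 1)).coeff 0 = a at *
    generalize (c (i + 1)).coeff 1 = b at *
    generalize (c (i + 2)).coeff 0 = a₂ at *
    generalize (c (i + 2)).coeff 1 = b₂ at *
    have h' : C (a * (a₂ - a₀ - μ.α)) +
        C (a * (b₂ - b₀ - μ.α') + b * (a₂ - a₀ - μ.α) - b * μ.β) * X +
        C (b * (b₂ - b₀ - μ.α') - b * μ.β') * X ^ 2 = 0 := by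
      simp only [tCoeff, xCoeff, derivative_add, derivative_mul, derivative_C, derivative_X] at h
      simp only [map_add, map_sub, map_mul]
      linear_combination h
    have e0 := congrArg (coeff · 0) h'
    have e1 := congrArg (coeff · 1) h'
    have e2 := congrArg (coeff · 2) h'
    simp [coeff_X, coeff_C, coeff_X_pow, -map_sub, -map_mul, -map_add] at e0 e1 e2
    refine .of_coeff_eq ?_ ?_ ?_ hn
    · grind
    · grind
    · grind
  have ha : (c 0).coeff 0 = 0 := by simp [h0]
  have hb : (c 0).coeff 1 = 0 := by simp [h0]
  have ha1 : (c 1).coeff 0 = μ.α + μ.γ := by simp [h1, firstCoeff]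
  have hb1 : (c 1).coeff 1 = μ.α' + μ.β' + μ.γ' := by simp [h1, firstCoeff, coeff_C]
  obtain ⟨α, β, γ, α', β', γ'⟩ := μ
  simp only at hs ha1 hb1
  simp only [families, Set.mem_union, family1a, family1b, family2a, family2b, family3a, family3b,
    family4a, family4b, family5, family6, Set.mem_ofPred_eq]
  by_cases hβ : β ≠ 0 ∨ β' ≠ 0
  swap
  · obtain ⟨rfl, rfl⟩ : β = 0 ∧ β' = 0 := by simpa using hβ
    exact Or.inl (Or.inr ⟨α, γ, α', γ', rfl⟩)
  by_cases hA : α + γ = 0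
  · obtain rfl : γ = -α := by linear_combination hA
    rcases classification_mul_X (a := fun i => (c i).coeff 0)
      (b := fun i => (c i).coeff 1) hβ ha hb hs (ha1.trans hA) with ⟨rfl, h⟩ | h | ⟨rfl, h⟩
    · obtain rfl : β' = -α' := by linear_combination h
      iterate 9 left
      exact ⟨β, α', γ', by simp⟩
    · obtain rfl : β = -α := by linear_combination h
      iterate 7 left
      exact Or.inr ⟨α, α', β', γ', rfl⟩
    · obtain rfl : α' = 0 := by linear_combination h
      iterate 5 left
      exact Or.inr ⟨β, β', γ', by simp⟩
  by_cases hB : α' + β' + γ' = 0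
  · rcases classification_const (a := fun i => (c i).coeff 0)
      (b := fun i => (c i).coeff 1) hβ ha hb hs (hb1.trans hB) with ⟨rfl, h⟩ | h | ⟨h, h'⟩
    · obtain rfl : β' = -α' := by linear_combination h
      obtain rfl : γ' = 0 := by linear_combination hB
      iterate 8 left
      exact Or.inr ⟨β, γ, α', rfl⟩
    · obtain rfl : α' = 0 := by linear_combination h
      obtain rfl : γ' = -β' := by linear_combination hB
      iterate 6 left
      exact Or.inr ⟨α, β, γ, β', rfl⟩
    · obtain rfl : β' = -α' := by linear_combination h
      obtain rfl : β = -α := by linear_combination h'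
      obtain rfl : γ' = 0 := by linear_combination hB
      iterate 4 left
      exact Or.inr ⟨α, γ, α', rfl⟩
  obtain ⟨hβ', hAB, h⟩ :=
    classification_two_terms (a := fun i => (c i).coeff 0)
      (b := fun i => (c i).coeff 1) hβ ha hb hs (ha1.trans_ne hA) (hb1.trans_ne hB)
  rw [ha1, hb1] at hAB
  rcases h with h | ⟨rfl, h⟩ | ⟨h, h'⟩
  · right
    refine ⟨β / β', α', β', γ', ?_⟩
    ext
    · simp only; field_simp; linear_combination h
    · simp only; field_simp
    · simp only; field_simp; linear_combination hAB - h
    all_goals rfl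
  · obtain rfl : α' = 0 := by linear_combination h
    iterate 3 left
    right
    refine ⟨β / β', β', γ', ?_⟩
    ext
    · rfl
    · simp only; field_simp
    · simp only; field_simp; linear_combination hAB
    all_goals rfl
  · obtain rfl : β' = -α' := by linear_combination h
    obtain rfl : β = -α := by linear_combination h'
    have hα : α ≠ 0 := by
      rintro rfl
      refine (mul_ne_zero hA hβ') ?_
      rw [hAB, neg_zero, mul_zero]
    iterate 2 left
    right
    refine ⟨α' / α, α, γ, ?_⟩
    ext
    · rfl
    · rfl
    · rfl
    · simp only; field_simp
    · simp only; field_simp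
    · simp only; field_simp; linear_combination hAB
end GKPParam

theorem theorem3p1 (μ : GKPParam) :
    ((∃ c : ℕ → Polynomial ℂ, (∀ i : ℕ, 1 ≤ i → c i ≠ 0) ∧ HasSFraction μ.ogf c) →
        μ ∈ GKPParam.families) ∧
      (μ ∈ GKPParam.families → ∃ c : ℕ → Polynomial ℂ, HasSFraction μ.ogf c) := by
  refine ⟨?_, μ.exists_hasSFraction_of_mem_families⟩
  rintro ⟨c, hne, hc⟩
  -- The value `c 0` is immaterial for the S-fraction; the recurrence needs it to be `0`.
  have hd (i : ℕ) (hi : 1 ≤ i) : c i = Function.update c 0 0 i := by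
    rw [Function.update_of_ne (by omega)]
  have hne' (i : ℕ) (hi : 1 ≤ i) : Function.update c 0 0 i ≠ 0 := hd i hi ▸ hne i hi
  obtain ⟨h1, hrec⟩ := μ.recurrence_of_hasSFraction (Function.update_self ..) hne' (hc.congr hd)
  exact μ.mem_families_of_recurrence (Function.update_self ..) h1 hne' hrec
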